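/- Let $n\ge 1$ and let $\mathbb H^n=\mathbb R^n\times\mathbb R^n\times\mathbb R$, with points $p=(x,y,z)$, be the Heisenberg group with law $(a,b,c)\circ(a',b',c')=(a+a',b+b',c+c'+\tfrac12(a\cdot b'-b\cdot a'))$, inverse $(a,b,c)^{-1}=(-a,-b,-c)$, Lebesgue (Haar) measure $dp$, homogeneous norm $|(a,b,c)|=\big((|a|^2+|b|^2)^2+c^2\big)^{1/4}$, homogeneous dimension $Q=2n+2$ and left invariant vector fields $X_i=\partial_{x_i}-\tfrac{y_i}{2}\partial_z$, $Y_i=\partial_{y_i}+\tfrac{x_i}{2}\partial_z$, $Z=\partial_z$. Let $W^{1,1}(\mathbb H^n)$ be the space of real $u\in L^1(\mathbb H^n)$ whose weak derivatives $X_iu,Y_iu$ $(1\le i\le n)$ are in $L^1(\mathbb H^n)$. For $0<s<1$ let $$(-\Delta)^su(p)=\mathrm{P.V.}\int_{\mathbb H^n}\frac{u(p)-u(q)}{|q^{-1}\circ p|^{Q+2s}}\,dq=\lim_{\varepsilon\to0^+}\int_{|q^{-1}\circ p|>\varepsilon}\frac{u(p)-u(q)}{|q^{-1}\circ p|^{Q+2s}}\,dq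 .$$ With the dilation-weighted position vector $\bar x=(x,y,2z)$, put $$\bar x\cdot\nabla_{\mathbb H^n}u=\sum_{i=1}^n x_iX_iu+\sum_{i=1}^n y_iY_iu+2z\,Zu .$$ **Theorem 5.1.** Let $0<s<1$ and let $u_1,u_2\in W^{1,1}(\mathbb H^n)$ have disjoint compact supports $\Omega_1,\Omega_2$. Then, for $j=1,2$, the principal value $(-\Delta)^su_j$ exists at every point of $\mathbb H^n\setminus\Omega_j$ and is a $C^1$ function there, and $$\int_{\Omega_1}(\bar x\cdot\nabla_{\mathbb H^n}u_1)(-\Delta)^su_2\,dp+\int_{\Omega_2}(\bar x\cdot\nabla_{\mathbb H^n}u_2)(-\Delta)^su_1\,dp=\frac{2s-Q}{2}\int_{\Omega_1}u_1(-\Delta)^su_2\,dp+\frac{2s-Q}{2}\int_{\Omega_2}u_2(-\Delta)^su_1\,dp .$$ Here all integrals converge absolutely if the weak derivatives $Zu_1,Zu_2$ are locally integrable functions. In general the identity holds with the vertical part understood in the sense of distributions, that is, with $\int_{\Omega_j}2z\,(Zu_j)\,f\,dp$ replaced by $-\int_{\Omega_j}u_j\,\partial_z(2zf)\,dp$, where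 $f=(-\Delta)^su_k$, $k\ne j$; again all integrals converge absolutely. -/

import Mathlib

open MeasureTheory Filter Topology
open scoped ContDiff

noncomputable section

/-- The underlying space `ℝⁿ × ℝⁿ × ℝ` of the Heisenberg group `ℍⁿ`; its points are written
`(x, y, z)`. The topology is the usual one and `volume` is Lebesgue measure, which is the Haar
measure of the group. (The Heisenberg group law is `Heis.mul` below; the componentwise operations
that the product type carries are not used as the group law.) -/
abbrev Heis (n : ℕ) : Type := (Fin n → ℝ) × (Fin n → ℝ) × ℝ

namespace Heis

variable {n : ℕ}

/-- The group law `(a,b,c) ∘ (a',b',c') = (a+a', b+b', c+c' + (a·b' - b·a')/2)`. -/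
def mul (p q : Heis n) : Heis n :=
  (p.1 + q.1, p.2.1 + q.2.1, p.2.2 + q.2.2 + (p.1 ⬝ᵥ q.2.1 - p.2.1 ⬝ᵥ q.1) / 2)

/-- The group inverse `(a,b,c)⁻¹ = (-a,-b,-c)`. -/
def inv (p : Heis n) : Heis n := (-p.1, -p.2.1, -p.2.2)

/-- The homogeneous norm `|(a,b,c)| = ((|a|² + |b|²)² + c²)^(1/4)`. -/
def hnorm (p : Heis n) : ℝ :=
  ((p.1 ⬝ᵥ p.1 + p.2.1 ⬝ᵥ p.2.1) ^ 2 + p.2.2 ^ 2) ^ ((1 : ℝ) / 4)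

/-- The homogeneous dimension `Q = 2n + 2`. -/
def homDim (n : ℕ) : ℝ := 2 * n + 2

/-- The left invariant vector field `X_i = ∂/∂x_i - (y_i/2) ∂/∂z`. -/
def fieldX (i : Fin n) (p : Heis n) : Heis n := (Pi.single i 1, 0, -(p.2.1 i) / 2)

/-- The left invariant vector field `Y_i = ∂/∂y_i + (x_i/2) ∂/∂z`. -/
def fieldY (i : Fin n) (p : Heis n) : Heis n := (0, Pi.single i 1, p.1 i / 2)

/-- The left invariant vector field `Z = ∂/∂z`. -/
def fieldZ (_ : Heis n) : Heis n := (0, 0, 1)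

/-- `g` is a weak derivative of `u` along the vector field `V`:
`∫ u (V φ) = - ∫ g φ` for all test functions `φ ∈ C_c^∞`. It is used only for the
divergence-free fields `X_i`, `Y_i`, `Z`, for which the formal adjoint of `V` is `-V`. -/
def HasWeakDeriv (V : Heis n → Heis n) (u g : Heis n → ℝ) : Prop :=
  LocallyIntegrable g volume ∧
    ∀ φ : Heis n → ℝ, ContDiff ℝ ∞ φ → HasCompactSupport φ →
      ∫ p, u p * fderiv ℝ φ p (V p) = -∫ p, g p * φ p

/-- `g = ((X_1 u, …, X_n u), (Y_1 u, …, Y_n u))` is a version of the weak subgradient of `u`. -/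
def IsSubgradient (u : Heis n → ℝ) (g : Heis n → (Fin n → ℝ) × (Fin n → ℝ)) : Prop :=
  (∀ i, HasWeakDeriv (fieldX i) u (fun p => (g p).1 i)) ∧
    ∀ i, HasWeakDeriv (fieldY i) u (fun p => (g p).2 i)

/-- The Sobolev space `W^{1,1}(ℍⁿ)`: `u ∈ L¹` with weak subgradient in `L¹`. -/
def MemW11 (u : Heis n → ℝ) : Prop :=
  Integrable u volume ∧
    ∃ g : Heis n → (Fin n → ℝ) × (Fin n → ℝ), Integrable g volume ∧ IsSubgradient u g

/-- The truncated integral `∫_{|y⁻¹ ∘ x| > ε} (u(x) - u(y)) / |y⁻¹ ∘ x|^(Q+2s) dy`. -/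
def truncFracLaplacian (s : ℝ) (u : Heis n → ℝ) (x : Heis n) (ε : ℝ) : ℝ :=
  ∫ y in {y : Heis n | ε < hnorm (mul (inv y) x)},
    (u x - u y) / hnorm (mul (inv y) x) ^ (homDim n + 2 * s)

/-- The principal value defining `(-Δ)^s u (x)` exists and equals `L`. -/
def HasFracLaplacianAt (s : ℝ) (u : Heis n → ℝ) (x : Heis n) (L : ℝ) : Prop :=
  Tendsto (truncFracLaplacian s u x) (𝓝[>] 0) (𝓝 L)

/-- The fractional Laplacian `(-Δ)^s u (x) = P.V. ∫ (u(x) - u(y)) / |y⁻¹ ∘ x|^(Q+2s) dy`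
(a junk value where the principal value does not exist). -/
def fracLaplacian (s : ℝ) (u : Heis n → ℝ) (x : Heis n) : ℝ :=
  limUnder (𝓝[>] 0) (truncFracLaplacian s u x)

/-- The position vector weighted by the dilation exponents, `x̄ = (x, y, 2z)`. -/
def wpos (p : Heis n) : Heis n := (p.1, p.2.1, 2 * p.2.2)

/-- The Euclidean scalar product of `ℝ^(2n+1)`. -/
def dot (v w : Heis n) : ℝ := v.1 ⬝ᵥ w.1 + v.2.1 ⬝ᵥ w.2.1 + v.2.2 * w.2.2

/-- `x̄ · (X_1 u, …, X_n u, Y_1 u, …, Y_n u, Z u)`, for `g` the subgradient of `u` and `T = Z u`. -/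
def wposDotGrad (g : Heis n → (Fin n → ℝ) × (Fin n → ℝ)) (T : Heis n → ℝ) (p : Heis n) : ℝ :=
  dot (wpos p) ((g p).1, (g p).2, T p)

/-- `∂/∂z (2 z f)`, the derivative of `2 z f` along `Z`. -/
def zDerivWeighted (f : Heis n → ℝ) (p : Heis n) : ℝ :=
  deriv (fun t : ℝ => 2 * t * f (p.1, p.2.1, t)) p.2.2

end Heis

end

/-! Off its support `u` vanishes, so there the fractional Laplacian is the potential -∫ u(q) k(p,q)
dq with k = |q⁻¹∘p|^(-(Q+2s)). This is smooth, because k is smooth off the diagonal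
(`contDiffOn_fracLaplacian`). Each left-hand term is integrated by parts against this smooth f. In Σ
x_i X_i + Σ y_i Y_i the vertical parts cancel, so the field is the Euclidean (x, y, 2z), of
divergence Q, and the term becomes -Q∫uf - ∫ u Df(x̄) (`IsSubgradient.pairing_eq`). Put S = ∬ u₁(p)
u₂(q) k(p,q). By Fubini and the symmetry of k, both ∫uf equal -S, and the two derivative terms
together differentiate k along (x̄_p, x̄_q). That field generates the dilations, under which k is
homogeneous of degree -(Q+2s), so Euler's identity (`fderiv_kernel_wpos`) shows that both sides
equal (Q-2s)S. -/

/-! ### Potentials of kernels smooth off the diagonal. -/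

section SmoothKernels

/-- A convolution evaluated at 0 samples `g p` at `-q`, hence the reflection. Convolution serves
only as a device for differentiating in the parameter `p`. The hypothesis is on germs, so that
derivatives of `g` and `k` can be compared too. -/
theorem integral_mul_kernel_eq_convolution {E : Type*} [NormedAddCommGroup E] [MeasurableSpace E]
    {μ : Measure E} {u : E → ℝ} {k : E × E → ℝ} {g : E → E → ℝ}
    (h : ∀ p, ∀ q ∈ tsupport u, ↿g =ᶠ[𝓝 (p, -q)] fun w => k (w.1, -w.2)) (p : E) :
    ∫ q, u q * k (p, q) ∂μ =
      convolution u (g p) (ContinuousLinearMap.mul ℝ ℝ) μ 0 := by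
  refine integral_congr_ae (Eventually.of_forall fun q => ?_)
  by_cases hq : q ∈ tsupport u
  · have := (h p q hq).self_of_nhds
    simp only [neg_neg] at this
    simp only [ContinuousLinearMap.mul_apply', zero_sub, ← this]
    rfl
  · simp [image_eq_zero_of_notMem_tsupport hq]

variable {E : Type*} [NormedAddCommGroup E] [NormedSpace ℝ E] [FiniteDimensional ℝ E]

/-- A smooth compactly supported cutoff equal to `1` near a compact set. -/
theorem exists_contDiff_cutoff {K O : Set E} (hK : IsCompact K) (hO : IsOpen O) (h : K ⊆ O) :
    ∃ χ : E → ℝ, ContDiff ℝ ∞ χ ∧ HasCompactSupport χ ∧ tsupport χ ⊆ O ∧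
      ∀ x ∈ K, χ =ᶠ[𝓝 x] 1 := by
  obtain ⟨t, ht, hKt, htO⟩ := exists_compact_between hK hO h
  obtain ⟨f, h1, h0, -⟩ := exists_contMDiffMap_one_nhds_of_subset_interior (n := ⊤)
    (modelWithCornersSelf ℝ E) hK.isClosed hKt
  have hsub : tsupport f ⊆ t :=
    closure_minimal (fun x hx => by_contra fun hx' => hx (h0 x hx')) ht.isClosed
  refine ⟨f, f.contMDiff.contDiff, ht.of_isClosed_subset (isClosed_tsupport _) hsub,
    hsub.trans htO, fun x hx => ?_⟩
  exact h1.filter_mono (nhds_le_nhdsSet hx)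

/-- Away from `tsupport χ` the product vanishes locally, so `φ` need only be smooth where `χ` lives.
-/
theorem contDiffOn_mul_of_tsupport_subset {F : Type*} [NormedAddCommGroup F] [NormedSpace ℝ F]
    {χ φ : F → ℝ} {O S : Set F}
    (hO : IsOpen O) (hχ : ContDiff ℝ ∞ χ) (hφ : ContDiffOn ℝ ∞ φ O)
    (h : ∀ x ∈ S, x ∈ tsupport χ → x ∈ O) : ContDiffOn ℝ ∞ (fun x => χ x * φ x) S := by
  intro x hx
  refine ContDiffAt.contDiffWithinAt ?_
  by_cases hxs : x ∈ tsupport χ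
  · exact hχ.contDiffAt.mul (hφ.contDiffAt (hO.mem_nhds (h x hx hxs)))
  · have : (fun x => χ x * φ x) =ᶠ[𝓝 x] fun _ => 0 := by
      filter_upwards [notMem_tsupport_iff_eventuallyEq.1 hxs] with y hy
      simp [hy]
    exact contDiffAt_const.congr_of_eventuallyEq this

variable {u : E → ℝ} {k : E × E → ℝ}

/-- Off the support of `u`, a kernel that is smooth off the diagonal can be replaced by one that
is smooth everywhere and compactly supported in the second variable, as is needed to apply
the theory of convolutions. -/
theorem exists_smooth_cutoff_kernel (hc : HasCompactSupport u)
    (hk : ContDiffOn ℝ ∞ k {w | w.1 ≠ w.2}) {p₀ : E} (hp₀ : p₀ ∉ tsupport u) :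
    ∃ (s K : Set E) (g : E → E → ℝ), IsOpen s ∧ p₀ ∈ s ∧ IsCompact K ∧
      (∀ p, ∀ x, p ∈ s → x ∉ K → g p x = 0) ∧ ContDiffOn ℝ ∞ ↿g (s ×ˢ Set.univ) ∧
      ∀ p, ∀ q ∈ tsupport u, ↿g =ᶠ[𝓝 (p, -q)] fun w => k (w.1, -w.2) := by
  obtain ⟨χ, hχ, hχc, hχs, hχ1⟩ := exists_contDiff_cutoff (hc : IsCompact (tsupport u))
    (isOpen_compl_singleton (x := p₀)) (fun x hx hx' => hp₀ (hx' ▸ hx))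
  -- `χ` is supported away from `p₀`. For `p` off its support, the factor `χ (-x)` kills the kernel
  -- near the diagonal `p = -x`.
  refine ⟨(tsupport χ)ᶜ, Neg.neg ⁻¹' tsupport χ, fun p x => χ (-x) * k (p, -x),
    (isClosed_tsupport χ).isOpen_compl, fun h => hχs h rfl, (Homeomorph.neg E).isCompact_preimage.2 hχc, ?_, ?_, ?_⟩
  · intro p x _ hx
    have : χ (-x) = 0 := image_eq_zero_of_notMem_tsupport (by simpa using hx)
    simp [this]
  · have hneg : Continuous fun w : E × E => -w.2 := by fun_prop
    refine contDiffOn_mul_of_tsupport_subset (χ := fun w : E × E => χ (-w.2))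
      (φ := fun w : E × E => k (w.1, -w.2)) (O := {w | w.1 ≠ -w.2})
      (isOpen_ne_fun continuous_fst hneg) (hχ.comp (by fun_prop)) ?_ ?_
    · exact hk.comp (g := k) (f := fun w : E × E => (w.1, -w.2))
        (by fun_prop : ContDiff ℝ ∞ _).contDiffOn (fun w hw => hw)
    · intro w hw hwt heq
      have : -w.2 ∈ tsupport χ := tsupport_comp_subset_preimage χ hneg hwt
      exact hw.1 (heq ▸ this)
  · intro p q hq
    have ht : Tendsto (fun w : E × E => -w.2) (𝓝 (p, -q)) (𝓝 q) := by
      have : Continuous fun w : E × E => -w.2 := by fun_prop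
      simpa using this.tendsto (p, -q)
    filter_upwards [ht.eventually (hχ1 q hq)] with w hw
    change χ (-w.2) * k (w.1, -w.2) = _
    rw [hw]; simp

variable [MeasurableSpace E] [BorelSpace E] {μ : Measure E}

/-- Potentials of compactly supported functions are smooth off the support. -/
theorem contDiffOn_integral_mul_kernel (hu : LocallyIntegrable u μ) (hc : HasCompactSupport u)
    (hk : ContDiffOn ℝ ∞ k {w | w.1 ≠ w.2}) :
    ContDiffOn ℝ ∞ (fun p => ∫ q, u q * k (p, q) ∂μ) (tsupport u)ᶜ := by
  intro p hp
  obtain ⟨s, K, g, hs, hps, hK, hgK, hg, hgk⟩ := exists_smooth_cutoff_kernel hc hk hp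
  simp_rw [integral_mul_kernel_eq_convolution hgk]
  have := contDiffOn_convolution_right_with_param (ContinuousLinearMap.mul ℝ ℝ) (μ := μ)
    hs hK hgK hu hg
  have h2 := this.comp (g := _) (f := fun p : E => (p, (0 : E))) (s := s)
    (by fun_prop : ContDiff ℝ ∞ _).contDiffOn (fun p hp => ⟨hp, trivial⟩)
  exact (h2.contDiffAt (hs.mem_nhds hps)).contDiffWithinAt

/-- Differentiation of a potential under the integral sign, off the support. -/
theorem fderiv_integral_mul_kernel (hu : LocallyIntegrable u μ) (hc : HasCompactSupport u)
    (hk : ContDiffOn ℝ ∞ k {w | w.1 ≠ w.2}) {p : E} (hp : p ∉ tsupport u) (v : E) :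
    fderiv ℝ (fun p => ∫ q, u q * k (p, q) ∂μ) p v =
      ∫ q, u q * fderiv ℝ k (p, q) (v, 0) ∂μ := by
  obtain ⟨s, K, g, hs, hps, hK, hgK, hg, hgk⟩ := exists_smooth_cutoff_kernel hc hk hp
  simp_rw [integral_mul_kernel_eq_convolution hgk]
  have hg1 : ContDiffOn ℝ 1 ↿g (s ×ˢ Set.univ) := hg.of_le (by exact_mod_cast le_top)
  have hopen : IsOpen (s ×ˢ (Set.univ : Set E)) := hs.prod isOpen_univ
  have hconv := hasFDerivAt_convolution_right_with_param (ContinuousLinearMap.mul ℝ ℝ) (μ := μ)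
    hs hK hgK hu hg1 (p, 0) hps
  have hconv' : HasFDerivAt _ _ ((fun p : E => (id p, (0 : E))) p) := hconv
  have hcomp := HasFDerivAt.comp (f := fun p : E => (id p, (0 : E))) p hconv' ((hasFDerivAt_id p).prodMk (hasFDerivAt_const (0 : E) p))
  have hfd := hcomp.fderiv
  rw [show (fun p : E => convolution u (g p) (ContinuousLinearMap.mul ℝ ℝ) μ 0) =
    (fun q : E × E => convolution u (g q.1) (ContinuousLinearMap.mul ℝ ℝ) μ q.2) ∘
      fun p => (id p, 0) from rfl, hfd]
  have hcont : Continuous fun x : E => fderiv ℝ ↿g (p, x) :=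
    (hg1.continuousOn_fderiv_of_isOpen hopen le_rfl).comp_continuous (by fun_prop)
      fun x => ⟨hps, trivial⟩
  -- `g` vanishes on the open set `s ×ˢ Kᶜ`, hence so does its derivative. Together with continuity
  -- this gives the integrability needed to evaluate at `v` inside the integral.
  have hsupp : HasCompactSupport fun x : E => fderiv ℝ ↿g (p, x) := by
    refine HasCompactSupport.intro hK fun x hx => ?_
    have : ↿g =ᶠ[𝓝 (p, x)] fun _ => 0 := by
      filter_upwards [(hs.prod hK.isClosed.isOpen_compl).mem_nhds ⟨hps, hx⟩] with w hw
      exact hgK w.1 w.2 hw.1 hw.2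
    rw [this.fderiv_eq]; simp
  have hint := hsupp.convolutionExists_right
    ((ContinuousLinearMap.mul ℝ ℝ).precompR (E × E)) (μ := μ) hu hcont 0
  simp only [ContinuousLinearMap.comp_apply, convolution]
  rw [ContinuousLinearMap.integral_apply hint]
  refine integral_congr_ae (Eventually.of_forall fun q => ?_)
  by_cases hq : q ∈ tsupport u
  · simp only [ContinuousLinearMap.precompR_apply, zero_sub]
    rw [(hgk p q hq).fderiv_eq]
    have hkd : HasFDerivAt k (fderiv ℝ k (p, q)) (p, - -q) := by
      rw [neg_neg]
      have hpq : (p, q) ∈ {w : E × E | w.1 ≠ w.2} := fun h : p = q => hp (h ▸ hq)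
      exact ((hk.contDiffAt ((isOpen_ne_fun continuous_fst continuous_snd).mem_nhds
        hpq)).differentiableAt (by simp)).hasFDerivAt
    -- The reflection acts on the second variable only, so it does not affect the direction `(v,
    -- 0)`.
    have hin : HasFDerivAt (fun w : E × E => (w.1, -w.2))
        ((ContinuousLinearMap.fst ℝ E E).prod (-ContinuousLinearMap.snd ℝ E E)) (p, -q) :=
      hasFDerivAt_fst.prodMk hasFDerivAt_snd.neg
    have := HasFDerivAt.comp (p, -q) (g := k) hkd hin
    rw [show (fun w : E × E => k (w.1, -w.2)) = k ∘ fun w : E × E => (w.1, -w.2) from rfl,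
      this.fderiv]
    simp
  · simp [image_eq_zero_of_notMem_tsupport hq]

end SmoothKernels

/-! ### Weak derivatives and integration by parts. -/

namespace Heis

variable {n : ℕ} {u f : Heis n → ℝ} {g : Heis n → (Fin n → ℝ) × (Fin n → ℝ)} {O : Set (Heis n)}

/-- Test functions supported off `tsupport u` integrate to zero against `h`. This allows integrals
of `h` to be restricted to `tsupport u`. -/
theorem HasWeakDeriv.ae_eq_zero {V : Heis n → Heis n} {h : Heis n → ℝ}
    (hw : HasWeakDeriv V u h) : ∀ᵐ p, p ∉ tsupport u → h p = 0 := by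
  have := (isClosed_tsupport u).isOpen_compl.ae_eq_zero_of_integral_contDiff_smul_eq_zero
    (μ := volume) (f := h) (hw.1.locallyIntegrableOn _) (fun φ hφ hφc hφs => ?_)
  · filter_upwards [this] with p hp using hp
  · have h1 := hw.2 φ hφ hφc
    have h0 : ∫ p, u p * fderiv ℝ φ p (V p) = 0 := by
      refine integral_eq_zero_of_ae (Eventually.of_forall fun p => ?_)
      by_cases hp : p ∈ tsupport u
      · have : φ =ᶠ[𝓝 p] fun _ => 0 := notMem_tsupport_iff_eventuallyEq.1 fun h => hφs h hp
        simp [this.fderiv_eq]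
      · simp [image_eq_zero_of_notMem_tsupport hp]
    simp only [smul_eq_mul, mul_comm (φ _)]
    linarith

/-- Integration by parts against functions that are smooth only near the support of `u`. -/
theorem HasWeakDeriv.setIntegral_mul {V : Heis n → Heis n} {h φ : Heis n → ℝ}
    (hw : HasWeakDeriv V u h) (hc : HasCompactSupport u) (hO : IsOpen O) (hKO : tsupport u ⊆ O)
    (hφ : ContDiffOn ℝ ∞ φ O) :
    ∫ p in tsupport u, h p * φ p = -∫ p in tsupport u, u p * fderiv ℝ φ p (V p) := by
  obtain ⟨χ, hχ, hχc, hχs, hχ1⟩ := exists_contDiff_cutoff (hc : IsCompact (tsupport u)) hO hKO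
  have hm : MeasurableSet (tsupport u) := (isClosed_tsupport u).measurableSet
  have hprod : ContDiff ℝ ∞ fun p => χ p * φ p :=
    contDiffOn_univ.1 (contDiffOn_mul_of_tsupport_subset hO hχ hφ fun x _ hx => hχs hx)
  have key := hw.2 _ hprod hχc.mul_right
  have heq : ∀ p ∈ tsupport u, (fun p => χ p * φ p) =ᶠ[𝓝 p] φ := fun p hp => by
    filter_upwards [hχ1 p hp] with q hq
    simp [hq]
  have h1 : ∫ p, h p * (χ p * φ p) = ∫ p in tsupport u, h p * φ p := by
    rw [← integral_indicator hm]
    refine integral_congr_ae ?_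
    filter_upwards [hw.ae_eq_zero] with p hp
    by_cases hpK : p ∈ tsupport u
    · rw [Set.indicator_of_mem hpK]
      congr 1
      exact (heq p hpK).self_of_nhds
    · rw [Set.indicator_of_notMem hpK, hp hpK, zero_mul]
  have h2 : ∫ p, u p * fderiv ℝ (fun p => χ p * φ p) p (V p) =
      ∫ p in tsupport u, u p * fderiv ℝ φ p (V p) := by
    rw [← integral_indicator hm]
    refine integral_congr_ae (Eventually.of_forall fun p => ?_)
    by_cases hpK : p ∈ tsupport u
    · simp only [Set.indicator_of_mem hpK, (heq p hpK).fderiv_eq]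
    · simp only [Set.indicator_of_notMem hpK, image_eq_zero_of_notMem_tsupport hpK, zero_mul]
  linarith

/-- Product rule along the vertical line. The term `2 * f p` supplies the 2 in Q = 2n + 2, the other
the vertical part of `wpos`. -/
theorem zDerivWeighted_eq {p : Heis n} (hf : DifferentiableAt ℝ f p) :
    zDerivWeighted f p = 2 * f p + fderiv ℝ f p (0, 0, 2 * p.2.2) := by
  have hcurve : HasDerivAt (fun t : ℝ => ((p.1, p.2.1, t) : Heis n)) (0, 0, 1) p.2.2 :=
    (hasDerivAt_const _ _).prodMk ((hasDerivAt_const _ _).prodMk (hasDerivAt_id _))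
  have hf' : HasFDerivAt f (fderiv ℝ f p) (p.1, p.2.1, p.2.2) := hf.hasFDerivAt
  have hcomp := hf'.comp_hasDerivAt p.2.2 hcurve
  have := (((hasDerivAt_id p.2.2).const_mul 2).mul hcomp).deriv
  refine this.trans ?_
  have hv : ((0, 0, 2 * p.2.2) : Heis n) = (2 * p.2.2) • ((0, 0, 1) : Heis n) := by
    ext <;> simp
  rw [hv, map_smul]
  simp

theorem fderiv_mul_apply_clm {p : Heis n} (ℓ : Heis n →L[ℝ] ℝ) (hf : DifferentiableAt ℝ f p)
    (v : Heis n) :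
    fderiv ℝ (fun q => ℓ q * f q) p v = ℓ v * f p + ℓ p * fderiv ℝ f p v := by
  have := (ℓ.hasFDerivAt (x := p)).mul hf.hasFDerivAt
  refine (DFunLike.congr_fun this.fderiv v).trans ?_
  simp
  ring

theorem wposDotGrad_eq (T : Heis n → ℝ) (p : Heis n) :
    wposDotGrad g T p * f p = wposDotGrad g 0 p * f p + T p * (2 * p.2.2 * f p) := by
  simp only [wposDotGrad, dot, wpos, Pi.zero_apply]
  ring

theorem wposDotGrad_zero_eq (p : Heis n) :
    wposDotGrad g 0 p * f p = (∑ i, (g p).1 i * (p.1 i * f p)) +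
      ∑ i, (g p).2 i * (p.2.1 i * f p) := by
  simp only [wposDotGrad, dot, wpos, Pi.zero_apply, dotProduct, mul_zero, add_zero, add_mul,
    Finset.sum_mul]
  congr 1 <;> exact Finset.sum_congr rfl fun i _ => by ring

/-- The coordinate functional `x_i`. -/
def coordX (i : Fin n) : Heis n →L[ℝ] ℝ :=
  (ContinuousLinearMap.proj i).comp (ContinuousLinearMap.fst ℝ _ _)

/-- The coordinate functional `y_i`. -/
def coordY (i : Fin n) : Heis n →L[ℝ] ℝ :=
  (ContinuousLinearMap.proj i).comp
    ((ContinuousLinearMap.fst ℝ _ _).comp (ContinuousLinearMap.snd ℝ _ _))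

/-- The coordinate functional `z`. -/
def coordZ : Heis n →L[ℝ] ℝ :=
  (ContinuousLinearMap.snd ℝ _ _).comp (ContinuousLinearMap.snd ℝ _ _)

@[simp] theorem coordX_apply (i : Fin n) (p : Heis n) : coordX i p = p.1 i := rfl
@[simp] theorem coordY_apply (i : Fin n) (p : Heis n) : coordY i p = p.2.1 i := rfl
@[simp] theorem coordZ_apply (p : Heis n) : coordZ p = p.2.2 := rfl

/-- In `Σ x_i X_i + Σ y_i Y_i` the vertical components of the fields cancel. -/
theorem sum_smul_fields (p : Heis n) :
    (∑ i, p.1 i • fieldX i p) + ∑ i, p.2.1 i • fieldY i p = (p.1, p.2.1, 0) := by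
  refine Prod.ext ?_ (Prod.ext ?_ ?_)
  · funext j
    simp [fieldX, fieldY, Prod.fst_sum, Finset.sum_apply, Pi.single_apply]
  · funext j
    simp [fieldX, fieldY, Prod.fst_sum, Prod.snd_sum, Finset.sum_apply, Pi.single_apply]
  · simp only [fieldX, fieldY, Prod.snd_add, Prod.snd_sum, Prod.smul_snd, smul_eq_mul,
      ← Finset.sum_add_distrib]
    exact Finset.sum_eq_zero fun i _ => by ring

theorem HasWeakDeriv.integrableOn_mul {V : Heis n → Heis n} {h φ : Heis n → ℝ}
    (hw : HasWeakDeriv V u h) (hc : HasCompactSupport u) (hφ : ContinuousOn φ (tsupport u)) :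
    IntegrableOn (fun p => h p * φ p) (tsupport u) :=
  (hw.1.integrableOn_isCompact hc).mul_continuousOn hφ hc

theorem IsSubgradient.integrableOn (hg : IsSubgradient u g) (hc : HasCompactSupport u)
    (hf : ContinuousOn f (tsupport u)) :
    IntegrableOn (fun p => wposDotGrad g 0 p * f p) (tsupport u) := by
  simp only [wposDotGrad_zero_eq]
  refine Integrable.add (integrable_finsetSum _ fun i _ => ?_)
    (integrable_finsetSum _ fun i _ => ?_)
  · exact (hg.1 i).integrableOn_mul hc ((coordX i).continuous.continuousOn.mul hf)
  · exact (hg.2 i).integrableOn_mul hc ((coordY i).continuous.continuousOn.mul hf)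

/-- The divergence theorem for the horizontal part of `x̄ · ∇u`. -/
theorem IsSubgradient.setIntegral_wposDotGrad (hg : IsSubgradient u g) (hu : Integrable u)
    (hc : HasCompactSupport u) (hO : IsOpen O) (hKO : tsupport u ⊆ O)
    (hf : ContDiffOn ℝ ∞ f O) :
    ∫ p in tsupport u, wposDotGrad g 0 p * f p =
      -∫ p in tsupport u, u p * (2 * n * f p + fderiv ℝ f p (p.1, p.2.1, 0)) := by
  have hfc : ContinuousOn f (tsupport u) := hf.continuousOn.mono hKO
  have hdf : ContinuousOn (fderiv ℝ f) (tsupport u) :=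
    (hf.continuousOn_fderiv_of_isOpen hO (by simp)).mono hKO
  have hfd : ∀ p ∈ tsupport u, DifferentiableAt ℝ f p := fun p hp =>
    (hf.contDiffAt (hO.mem_nhds (hKO hp))).differentiableAt (by simp)
  have hm : MeasurableSet (tsupport u) := (isClosed_tsupport u).measurableSet
  -- Each coordinate is paired with its own field, along which it has derivative 1. Each of the 2n
  -- pairs therefore contributes one copy of `f`.
  have part : ∀ (ℓ : Heis n →L[ℝ] ℝ) (V : Heis n → Heis n) (h : Heis n → ℝ), Continuous V →
      (∀ p, ℓ (V p) = 1) → HasWeakDeriv V u h →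
      IntegrableOn (fun p => u p * (f p + fderiv ℝ f p (ℓ p • V p))) (tsupport u) ∧
      ∫ p in tsupport u, h p * (ℓ p * f p) =
        -∫ p in tsupport u, u p * (f p + fderiv ℝ f p (ℓ p • V p)) := by
    intro ℓ V h hV hℓ hw
    constructor
    · exact hu.integrableOn.mul_continuousOn
        (hfc.add (hdf.clm_apply (ℓ.continuous.smul hV).continuousOn)) hc
    · rw [hw.setIntegral_mul hc hO hKO (ℓ.contDiff.contDiffOn.mul hf)]
      congr 1
      refine setIntegral_congr_fun hm fun p hp => ?_
      simp only [fderiv_mul_apply_clm ℓ (hfd p hp), hℓ, map_smul, one_mul, smul_eq_mul]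
  have hX := fun i => part (coordX i) (fieldX i) _ (by unfold fieldX; fun_prop)
    (fun p => by simp [fieldX]) (hg.1 i)
  have hY := fun i => part (coordY i) (fieldY i) _ (by unfold fieldY; fun_prop)
    (fun p => by simp [fieldY]) (hg.2 i)
  simp only [wposDotGrad_zero_eq]
  rw [integral_add, integral_finsetSum, integral_finsetSum]
  · simp only [← coordX_apply, ← coordY_apply]
    simp_rw [fun i => (hX i).2, fun i => (hY i).2, Finset.sum_neg_distrib]
    rw [← neg_add, ← integral_finsetSum _ fun i _ => (hX i).1,
      ← integral_finsetSum _ fun i _ => (hY i).1,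
      ← integral_add (integrable_finsetSum _ fun i _ => (hX i).1)
        (integrable_finsetSum _ fun i _ => (hY i).1)]
    congr 1
    refine setIntegral_congr_fun hm fun p _ => ?_
    simp only [← Finset.mul_sum, ← mul_add, Finset.sum_add_distrib, coordX_apply, coordY_apply,
      ← sum_smul_fields p, map_add, map_sum, Finset.sum_const, Finset.card_univ, Fintype.card_fin,
      nsmul_eq_mul]
    ring
  all_goals first
    | exact fun i _ => (hg.1 i).integrableOn_mul hc ((coordX i).continuous.continuousOn.mul hfc)
    | exact fun i _ => (hg.2 i).integrableOn_mul hc ((coordY i).continuous.continuousOn.mul hfc)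
    | exact integrable_finsetSum _ fun i _ =>
        (hg.1 i).integrableOn_mul hc ((coordX i).continuous.continuousOn.mul hfc)
    | exact integrable_finsetSum _ fun i _ =>
        (hg.2 i).integrableOn_mul hc ((coordY i).continuous.continuousOn.mul hfc)

theorem integrableOn_mul_zDerivWeighted (hu : Integrable u)
    (hc : HasCompactSupport u) (hO : IsOpen O) (hKO : tsupport u ⊆ O)
    (hf : ContDiffOn ℝ ∞ f O) :
    IntegrableOn (fun p => u p * zDerivWeighted f p) (tsupport u) := by
  have hdf : ContinuousOn (fderiv ℝ f) (tsupport u) :=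
    (hf.continuousOn_fderiv_of_isOpen hO (by simp)).mono hKO
  refine hu.integrableOn.mul_continuousOn (ContinuousOn.congr
    (f := fun p => 2 * f p + fderiv ℝ f p (0, 0, 2 * p.2.2)) ?_ fun p hp =>
    zDerivWeighted_eq ((hf.contDiffAt (hO.mem_nhds (hKO hp))).differentiableAt (by simp))) hc
  exact (continuousOn_const.mul (hf.continuousOn.mono hKO)).add
    (hdf.clm_apply (by fun_prop))

/-- The distributional pairing of `x̄ · ∇u` with `f`. -/
theorem IsSubgradient.pairing_eq (hg : IsSubgradient u g) (hu : Integrable u)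
    (hc : HasCompactSupport u) (hO : IsOpen O) (hKO : tsupport u ⊆ O)
    (hf : ContDiffOn ℝ ∞ f O) :
    (∫ p in tsupport u, wposDotGrad g 0 p * f p) - ∫ p in tsupport u, u p * zDerivWeighted f p =
      -(homDim n * (∫ p in tsupport u, u p * f p) +
        ∫ p in tsupport u, u p * fderiv ℝ f p (wpos p)) := by
  have hfc : ContinuousOn f (tsupport u) := hf.continuousOn.mono hKO
  have hdf : ContinuousOn (fderiv ℝ f) (tsupport u) :=
    (hf.continuousOn_fderiv_of_isOpen hO (by simp)).mono hKO
  have hm : MeasurableSet (tsupport u) := (isClosed_tsupport u).measurableSet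
  have hi : ∀ {φ : Heis n → ℝ}, ContinuousOn φ (tsupport u) →
      IntegrableOn (fun p => u p * φ p) (tsupport u) := fun hφ =>
    hu.integrableOn.mul_continuousOn hφ hc
  rw [hg.setIntegral_wposDotGrad hu hc hO hKO hf, ← neg_add', ← integral_const_mul,
    ← integral_add, ← integral_add]
  · congr 1
    refine setIntegral_congr_fun hm fun p hp => ?_
    have hsplit : wpos p = (p.1, p.2.1, 0) + (0, 0, 2 * p.2.2) := by simp [wpos]
    simp only [zDerivWeighted_eq
      ((hf.contDiffAt (hO.mem_nhds (hKO hp))).differentiableAt (by simp)), hsplit, map_add, homDim]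
    ring
  · exact (hi hfc).const_mul _
  · exact hi (hdf.clm_apply (by unfold wpos; fun_prop))
  · exact hi ((continuousOn_const.mul hfc).add (hdf.clm_apply (by fun_prop)))
  · exact integrableOn_mul_zDerivWeighted hu hc hO hKO hf

/-- Testing `Z u` against `2 z f` reduces the case of a function `T` to the distributional one. -/
theorem HasWeakDeriv.setIntegral_wposDotGrad {T : Heis n → ℝ} (hT : HasWeakDeriv fieldZ u T)
    (hg : IsSubgradient u g) (hc : HasCompactSupport u) (hO : IsOpen O)
    (hKO : tsupport u ⊆ O) (hf : ContDiffOn ℝ ∞ f O) :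
    IntegrableOn (fun p => wposDotGrad g T p * f p) (tsupport u) ∧
    ∫ p in tsupport u, wposDotGrad g T p * f p =
      (∫ p in tsupport u, wposDotGrad g 0 p * f p) -
        ∫ p in tsupport u, u p * zDerivWeighted f p := by
  have hfc : ContinuousOn f (tsupport u) := hf.continuousOn.mono hKO
  have h0 := hg.integrableOn hc hfc
  have h1 : IntegrableOn (fun p => T p * (2 * p.2.2 * f p)) (tsupport u) :=
    hT.integrableOn_mul hc ((by fun_prop : Continuous fun p : Heis n => 2 * p.2.2).continuousOn.mul
      hfc)
  simp only [fun p => wposDotGrad_eq (g := g) (f := f) T p]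
  refine ⟨h0.add h1, ?_⟩
  rw [integral_add h0 h1, sub_eq_add_neg]
  congr 1
  rw [hT.setIntegral_mul hc hO hKO
    ((by fun_prop : ContDiff ℝ ∞ fun p : Heis n => 2 * p.2.2).contDiffOn.mul hf)]
  congr 1
  refine setIntegral_congr_fun (isClosed_tsupport u).measurableSet fun p hp => ?_
  have hd := (hf.contDiffAt (hO.mem_nhds (hKO hp))).differentiableAt (by simp)
  have h2 := fderiv_mul_apply_clm ((2 : ℝ) • (coordZ : Heis n →L[ℝ] ℝ)) hd (fieldZ p)
  simp only [smul_apply, coordZ_apply, smul_eq_mul] at h2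
  have hv : ((0, 0, 2 * p.2.2) : Heis n) = (2 * p.2.2) • fieldZ p := by
    ext <;> simp [fieldZ]
  simp only [h2, zDerivWeighted_eq hd, hv, map_smul, smul_eq_mul]
  simp [fieldZ]


/-! ### The kernel: positivity, symmetry, homogeneity. -/

variable {s : ℝ}

/-- The fourth power of the homogeneous distance `|q⁻¹ ∘ p|`, as a polynomial in `(p, q)`. -/
noncomputable def quartic (w : Heis n × Heis n) : ℝ :=
  ((mul (inv w.2) w.1).1 ⬝ᵥ (mul (inv w.2) w.1).1 +
    (mul (inv w.2) w.1).2.1 ⬝ᵥ (mul (inv w.2) w.1).2.1) ^ 2 + (mul (inv w.2) w.1).2.2 ^ 2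

/-- The kernel `|q⁻¹ ∘ p|^(-(Q+2s))` of the fractional Laplacian. -/
noncomputable def kernel (s : ℝ) (w : Heis n × Heis n) : ℝ := quartic w ^ (-(homDim n + 2 * s) / 4)

/-- The dilation `(x, y, z) ↦ (t x, t y, t² z)`. -/
def dil (t : ℝ) (p : Heis n) : Heis n := (t • p.1, t • p.2.1, t ^ 2 * p.2.2)

theorem quartic_nonneg (w : Heis n × Heis n) : 0 ≤ quartic w := by
  unfold quartic; positivity

theorem quartic_pos {w : Heis n × Heis n} (hw : w.1 ≠ w.2) : 0 < quartic w := by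
  refine (quartic_nonneg w).lt_of_ne fun h => hw ?_
  have hnn : ∀ v : Fin n → ℝ, 0 ≤ v ⬝ᵥ v := fun v =>
    Finset.sum_nonneg fun i _ => mul_self_nonneg _
  unfold quartic at h
  have hz : (mul (inv w.2) w.1).2.2 = 0 := by
    have := sq_nonneg ((mul (inv w.2) w.1).1 ⬝ᵥ (mul (inv w.2) w.1).1 +
      (mul (inv w.2) w.1).2.1 ⬝ᵥ (mul (inv w.2) w.1).2.1)
    nlinarith [sq_nonneg (mul (inv w.2) w.1).2.2]
  have hs : (mul (inv w.2) w.1).1 ⬝ᵥ (mul (inv w.2) w.1).1 +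
      (mul (inv w.2) w.1).2.1 ⬝ᵥ (mul (inv w.2) w.1).2.1 = 0 := by
    rw [hz] at h
    simpa using h.symm
  have hx : (mul (inv w.2) w.1).1 = 0 := dotProduct_self_eq_zero.1
    (by linarith [hnn (mul (inv w.2) w.1).1, hnn (mul (inv w.2) w.1).2.1])
  have hy : (mul (inv w.2) w.1).2.1 = 0 := dotProduct_self_eq_zero.1
    (by linarith [hnn (mul (inv w.2) w.1).1, hnn (mul (inv w.2) w.1).2.1])
  simp only [mul, inv] at hx hy hz
  have hx' : w.1.1 = w.2.1 := by linear_combination hx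
  have hy' : w.1.2.1 = w.2.2.1 := by linear_combination hy
  -- Once the horizontal parts agree, the antisymmetric term of the group law vanishes, leaving
  -- equality of the `z` coordinates.
  rw [hx', hy', neg_dotProduct, neg_dotProduct, dotProduct_comm w.2.1] at hz
  exact Prod.ext hx' (Prod.ext hy' (by linear_combination hz))

/-- p⁻¹∘q is the inverse of q⁻¹∘p, and the norm is even. -/
theorem quartic_swap (w : Heis n × Heis n) : quartic w.swap = quartic w := by
  have h1 : (mul (inv w.1) w.2).1 = -(mul (inv w.2) w.1).1 := by simp [mul, inv]
  have h2 : (mul (inv w.1) w.2).2.1 = -(mul (inv w.2) w.1).2.1 := by simp [mul, inv]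
  have h3 : (mul (inv w.1) w.2).2.2 = -(mul (inv w.2) w.1).2.2 := by
    simp only [mul, inv, neg_dotProduct, dotProduct_comm w.2.2.1, dotProduct_comm w.2.1]
    ring
  simp only [quartic, Prod.fst_swap, Prod.snd_swap, h1, h2, h3, neg_dotProduct_neg, neg_sq]

/-- Dilations are compatible with the group law: its bilinear term scales by t², as `z` does. -/
theorem quartic_dil (t : ℝ) (p q : Heis n) :
    quartic (dil t p, dil t q) = t ^ 4 * quartic (p, q) := by
  have h1 : (mul (inv (dil t q)) (dil t p)).1 = t • (mul (inv q) p).1 := by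
    simp [mul, inv, dil]
  have h2 : (mul (inv (dil t q)) (dil t p)).2.1 = t • (mul (inv q) p).2.1 := by
    simp [mul, inv, dil]
  have h3 : (mul (inv (dil t q)) (dil t p)).2.2 = t ^ 2 * (mul (inv q) p).2.2 := by
    simp only [mul, inv, dil, neg_dotProduct, smul_dotProduct, dotProduct_smul, smul_eq_mul]
    ring
  simp only [quartic, h1, h2, h3, smul_dotProduct, dotProduct_smul, smul_eq_mul]
  ring

theorem contDiff_quartic : ContDiff ℝ ∞ (quartic : Heis n × Heis n → ℝ) := by
  unfold quartic mul inv
  simp only [dotProduct]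
  fun_prop

theorem contDiffOn_kernel :
    ContDiffOn ℝ ∞ (kernel s : Heis n × Heis n → ℝ) {w | w.1 ≠ w.2} :=
  contDiff_quartic.contDiffOn.rpow_const_of_ne fun _ hw => (quartic_pos hw).ne'

theorem isOpen_offDiag : IsOpen {w : Heis n × Heis n | w.1 ≠ w.2} :=
  isOpen_ne_fun continuous_fst continuous_snd

theorem differentiableAt_kernel {w : Heis n × Heis n} (hw : w.1 ≠ w.2) :
    DifferentiableAt ℝ (kernel s) w :=
  (contDiffOn_kernel.contDiffAt (isOpen_offDiag.mem_nhds hw)).differentiableAt (by simp)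

theorem kernel_swap (w : Heis n × Heis n) : kernel s w.swap = kernel s w := by
  simp only [kernel, quartic_swap]

theorem hasDerivAt_dil_one (p : Heis n) : HasDerivAt (fun t => dil t p) (wpos p) 1 := by
  have h1 := (hasDerivAt_id (1 : ℝ)).smul_const p.1
  have h2 := (hasDerivAt_id (1 : ℝ)).smul_const p.2.1
  have h3 := ((hasDerivAt_id (1 : ℝ)).pow 2).mul_const p.2.2
  have := h1.prodMk (h2.prodMk h3)
  simpa [wpos, dil] using this

theorem dil_one (p : Heis n) : dil 1 p = p := by simp [dil]

/-- Euler's identity for the kernel, which is homogeneous of degree `-(Q+2s)`. -/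
theorem fderiv_kernel_wpos {p q : Heis n} (h : p ≠ q) :
    fderiv ℝ (kernel s) (p, q) (wpos p, wpos q) = -(homDim n + 2 * s) * kernel s (p, q) := by
  have hk : HasFDerivAt (kernel s) (fderiv ℝ (kernel s) (p, q)) (dil 1 p, dil 1 q) := by
    rw [dil_one, dil_one]
    exact (differentiableAt_kernel h).hasFDerivAt
  have h1 := hk.comp_hasDerivAt (1 : ℝ) ((hasDerivAt_dil_one p).prodMk (hasDerivAt_dil_one q))
  have h2 : HasDerivAt (fun t : ℝ => t ^ (-(homDim n + 2 * s)) * kernel s (p, q))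
      (-(homDim n + 2 * s) * kernel s (p, q)) 1 := by
    have := (Real.hasDerivAt_rpow_const (x := 1) (p := -(homDim n + 2 * s))
      (Or.inl one_ne_zero)).mul_const (kernel s (p, q))
    simpa using this
  -- Both are derivatives at t = 1 of the kernel along the dilation orbit. Homogeneity is needed
  -- only for t > 0, which holds near 1.
  refine h1.unique (h2.congr_of_eventuallyEq ?_)
  filter_upwards [lt_mem_nhds (zero_lt_one (α := ℝ))] with t ht
  simp only [Function.comp_apply, kernel, quartic_dil]
  rw [Real.mul_rpow (by positivity) (quartic_nonneg _), ← Real.rpow_natCast,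
    ← Real.rpow_mul ht.le]
  congr 2
  push_cast
  ring

/-- Differentiate the symmetry of the kernel. This turns the second potential's derivative into the
missing half of Euler's identity. -/
theorem fderiv_kernel_swap {p q : Heis n} (h : p ≠ q) (v : Heis n) :
    fderiv ℝ (kernel s) (q, p) (v, 0) = fderiv ℝ (kernel s) (p, q) (0, v) := by
  have hk : HasFDerivAt (kernel s) (fderiv ℝ (kernel s) (q, p)) (Prod.swap (p, q)) :=
    (differentiableAt_kernel h.symm).hasFDerivAt
  have hsw : HasFDerivAt Prod.swap ((ContinuousLinearMap.snd ℝ (Heis n) (Heis n)).prod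
      (ContinuousLinearMap.fst ℝ (Heis n) (Heis n))) (p, q) :=
    hasFDerivAt_snd.prodMk hasFDerivAt_fst
  have := HasFDerivAt.comp (p, q) hk hsw
  rw [show kernel s ∘ Prod.swap = kernel s from funext kernel_swap] at this
  rw [this.fderiv]
  simp

/-! ### The fractional Laplacian off the support. -/

theorem inv_hnorm_rpow (p q : Heis n) :
    1 / hnorm (mul (inv q) p) ^ (homDim n + 2 * s) = kernel s (p, q) := by
  have : hnorm (mul (inv q) p) = quartic (p, q) ^ ((1 : ℝ) / 4) := rfl
  rw [this, ← Real.rpow_mul (quartic_nonneg _), one_div, ← Real.rpow_neg (quartic_nonneg _), kernel]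
  congr 1
  ring

/-- The point lies at positive homogeneous distance from the compact support, so the truncated
integrals are constant once ε is below that distance. -/
theorem hasFracLaplacianAt_neg_integral (hc : HasCompactSupport u) {p : Heis n}
    (hp : p ∉ tsupport u) :
    HasFracLaplacianAt s u p (-∫ q, u q * kernel s (p, q)) := by
  have hcont : Continuous fun q : Heis n => hnorm (mul (inv q) p) := by
    have h1 : Continuous fun q : Heis n => quartic (p, q) :=
      contDiff_quartic.continuous.comp (by fun_prop)
    exact h1.rpow_const fun _ => Or.inr (by norm_num)
  obtain ⟨δ, hδ, hδK⟩ := IsCompact.exists_forall_le' hc hcont.continuousOn (a := 0) fun q hq =>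
    Real.rpow_pos_of_pos (quartic_pos (w := (p, q)) fun h => hp (by rwa [show p = q from h])) _
  refine tendsto_const_nhds.congr' ?_
  filter_upwards [Ioo_mem_nhdsGT hδ] with ε hε
  rw [truncFracLaplacian, setIntegral_eq_integral_of_forall_compl_eq_zero, ← integral_neg]
  · refine integral_congr_ae (Eventually.of_forall fun q => ?_)
    simp only [← inv_hnorm_rpow, image_eq_zero_of_notMem_tsupport hp]
    ring
  · intro q hq
    have : q ∉ tsupport u := fun h => hq (hε.2.trans_le (hδK q h))
    simp [image_eq_zero_of_notMem_tsupport hp, image_eq_zero_of_notMem_tsupport this]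

theorem fracLaplacian_eq (hc : HasCompactSupport u) {p : Heis n} (hp : p ∉ tsupport u) :
    fracLaplacian s u p = -∫ q, u q * kernel s (p, q) :=
  (hasFracLaplacianAt_neg_integral hc hp).limUnder_eq

theorem contDiffOn_fracLaplacian (hu : Integrable u) (hc : HasCompactSupport u) :
    ContDiffOn ℝ ∞ (fracLaplacian s u) (tsupport u)ᶜ :=
  (contDiffOn_integral_mul_kernel hu.locallyIntegrable hc contDiffOn_kernel).neg.congr
    fun _ hp => fracLaplacian_eq hc hp

theorem fderiv_fracLaplacian (hu : Integrable u) (hc : HasCompactSupport u) {p : Heis n}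
    (hp : p ∉ tsupport u) (v : Heis n) :
    fderiv ℝ (fracLaplacian s u) p v = -∫ q, u q * fderiv ℝ (kernel s) (p, q) (v, 0) := by
  have : fracLaplacian s u =ᶠ[𝓝 p] fun p => -∫ q, u q * kernel s (p, q) := by
    filter_upwards [(isClosed_tsupport u).isOpen_compl.mem_nhds hp] with q hq
    exact fracLaplacian_eq hc hq
  rw [this.fderiv_eq, fderiv_fun_neg, neg_apply,
    fderiv_integral_mul_kernel hu.locallyIntegrable hc contDiffOn_kernel hp]

/-! ### Fubini on the product of the supports. -/

section DoubleIntegrals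

variable {u₁ u₂ : Heis n → ℝ} {H : Heis n × Heis n → ℝ}

theorem integrableOn_prod_mul (hu₁ : Integrable u₁) (hu₂ : Integrable u₂)
    (hc₁ : HasCompactSupport u₁) (hc₂ : HasCompactSupport u₂)
    (hH : ContinuousOn H (tsupport u₁ ×ˢ tsupport u₂)) :
    IntegrableOn (fun z => u₁ z.1 * u₂ z.2 * H z) (tsupport u₁ ×ˢ tsupport u₂) :=
  (hu₁.mul_prod hu₂).integrableOn.mul_continuousOn hH (hc₁.prod hc₂)

theorem setIntegral_mul_integral (hu₁ : Integrable u₁) (hu₂ : Integrable u₂)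
    (hc₁ : HasCompactSupport u₁) (hc₂ : HasCompactSupport u₂)
    (hH : ContinuousOn H (tsupport u₁ ×ˢ tsupport u₂)) :
    ∫ p in tsupport u₁, u₁ p * ∫ q, u₂ q * H (p, q) =
      ∫ z in tsupport u₁ ×ˢ tsupport u₂, u₁ z.1 * u₂ z.2 * H z := by
  rw [Measure.volume_eq_prod (Heis n) (Heis n), setIntegral_prod _ (integrableOn_prod_mul hu₁ hu₂ hc₁ hc₂ hH)]
  refine setIntegral_congr_fun (isClosed_tsupport u₁).measurableSet fun p _ => ?_
  simp only [mul_assoc, integral_const_mul]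
  congr 1
  refine (setIntegral_eq_integral_of_forall_compl_eq_zero fun q hq => ?_).symm
  rw [image_eq_zero_of_notMem_tsupport hq, zero_mul]

/-- Interchanging the variables brings both pairings onto the same domain, where their integrands
can be added. -/
theorem setIntegral_mul_integral_swap (hu₁ : Integrable u₁) (hu₂ : Integrable u₂)
    (hc₁ : HasCompactSupport u₁) (hc₂ : HasCompactSupport u₂)
    (hH : ContinuousOn H (tsupport u₂ ×ˢ tsupport u₁)) :
    ∫ p in tsupport u₂, u₂ p * ∫ q, u₁ q * H (p, q) =
      ∫ z in tsupport u₁ ×ˢ tsupport u₂, u₁ z.1 * u₂ z.2 * H z.swap := by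
  rw [setIntegral_mul_integral hu₂ hu₁ hc₂ hc₁ hH, Measure.volume_eq_prod (Heis n) (Heis n),
    ← setIntegral_prod_swap]
  simp only [Prod.fst_swap, Prod.snd_swap, mul_comm (u₂ _)]

end DoubleIntegrals

/-! ### The identity for pairs. -/

/-- The Pohozaev-type identity for pairs of functions, with the integrations by parts
already carried out. -/
theorem fracLaplacian_euler_identity {u₁ u₂ : Heis n → ℝ}
    (hu₁ : Integrable u₁) (hu₂ : Integrable u₂)
    (hc₁ : HasCompactSupport u₁) (hc₂ : HasCompactSupport u₂)
    (hd : Disjoint (tsupport u₁) (tsupport u₂)) :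
    -(homDim n * (∫ p in tsupport u₁, u₁ p * fracLaplacian s u₂ p) +
        ∫ p in tsupport u₁, u₁ p * fderiv ℝ (fracLaplacian s u₂) p (wpos p)) +
      -(homDim n * (∫ p in tsupport u₂, u₂ p * fracLaplacian s u₁ p) +
        ∫ p in tsupport u₂, u₂ p * fderiv ℝ (fracLaplacian s u₁) p (wpos p)) =
    (2 * s - homDim n) / 2 * (∫ p in tsupport u₁, u₁ p * fracLaplacian s u₂ p) +
      (2 * s - homDim n) / 2 * (∫ p in tsupport u₂, u₂ p * fracLaplacian s u₁ p) := by
  have hm₁ : MeasurableSet (tsupport u₁) := (isClosed_tsupport u₁).measurableSet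
  have hm₂ : MeasurableSet (tsupport u₂) := (isClosed_tsupport u₂).measurableSet
  have hn₁ : ∀ p ∈ tsupport u₁, p ∉ tsupport u₂ := fun p h h' => Set.disjoint_left.1 hd h h'
  have hn₂ : ∀ p ∈ tsupport u₂, p ∉ tsupport u₁ := fun p h h' => Set.disjoint_left.1 hd h' h
  have hsub : tsupport u₁ ×ˢ tsupport u₂ ⊆ {w : Heis n × Heis n | w.1 ≠ w.2} :=
    fun w hw h => hn₁ w.1 hw.1 (h ▸ hw.2)
  have hsub' : tsupport u₂ ×ˢ tsupport u₁ ⊆ {w : Heis n × Heis n | w.1 ≠ w.2} :=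
    fun w hw h => hn₂ w.1 hw.1 (h ▸ hw.2)
  have hkc : ContinuousOn (kernel s : Heis n × Heis n → ℝ) {w | w.1 ≠ w.2} :=
    contDiffOn_kernel.continuousOn
  have hdk : ContinuousOn (fun w : Heis n × Heis n => fderiv ℝ (kernel s) w (wpos w.1, 0))
      {w | w.1 ≠ w.2} :=
    (contDiffOn_kernel.continuousOn_fderiv_of_isOpen isOpen_offDiag (by simp)).clm_apply
      (by unfold wpos; fun_prop)
  have hS₁ : ∫ p in tsupport u₁, u₁ p * fracLaplacian s u₂ p =
      -∫ z in tsupport u₁ ×ˢ tsupport u₂, u₁ z.1 * u₂ z.2 * kernel s z := by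
    rw [← setIntegral_mul_integral hu₁ hu₂ hc₁ hc₂ (hkc.mono hsub), ← integral_neg]
    refine setIntegral_congr_fun hm₁ fun p hp => ?_
    simp only [fracLaplacian_eq hc₂ (hn₁ p hp), mul_neg]
  have hS₂ : ∫ p in tsupport u₂, u₂ p * fracLaplacian s u₁ p =
      -∫ z in tsupport u₁ ×ˢ tsupport u₂, u₁ z.1 * u₂ z.2 * kernel s z := by
    rw [show (∫ z in tsupport u₁ ×ˢ tsupport u₂, u₁ z.1 * u₂ z.2 * kernel s z) =
        ∫ z in tsupport u₁ ×ˢ tsupport u₂, u₁ z.1 * u₂ z.2 * kernel s z.swap by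
        simp only [kernel_swap],
      ← setIntegral_mul_integral_swap hu₁ hu₂ hc₁ hc₂ (hkc.mono hsub'), ← integral_neg]
    refine setIntegral_congr_fun hm₂ fun p hp => ?_
    simp only [fracLaplacian_eq hc₁ (hn₂ p hp), mul_neg]
  have hD₁ : ∫ p in tsupport u₁, u₁ p * fderiv ℝ (fracLaplacian s u₂) p (wpos p) =
      -∫ z in tsupport u₁ ×ˢ tsupport u₂,
        u₁ z.1 * u₂ z.2 * fderiv ℝ (kernel s) z (wpos z.1, 0) := by
    rw [← setIntegral_mul_integral hu₁ hu₂ hc₁ hc₂ (hdk.mono hsub), ← integral_neg]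
    refine setIntegral_congr_fun hm₁ fun p hp => ?_
    simp only [fderiv_fracLaplacian hu₂ hc₂ (hn₁ p hp), mul_neg]
  have hD₂ : ∫ p in tsupport u₂, u₂ p * fderiv ℝ (fracLaplacian s u₁) p (wpos p) =
      -∫ z in tsupport u₁ ×ˢ tsupport u₂,
        u₁ z.1 * u₂ z.2 * fderiv ℝ (kernel s) z.swap (wpos z.swap.1, 0) := by
    rw [← setIntegral_mul_integral_swap hu₁ hu₂ hc₁ hc₂ (hdk.mono hsub'), ← integral_neg]
    refine setIntegral_congr_fun hm₂ fun p hp => ?_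
    simp only [fderiv_fracLaplacian hu₁ hc₁ (hn₂ p hp), mul_neg]
  -- The two partial derivatives of the kernel add up to its derivative along `(wpos z.1, wpos
  -- z.2)`, to which Euler's identity applies.
  have hD : (∫ z in tsupport u₁ ×ˢ tsupport u₂,
        u₁ z.1 * u₂ z.2 * fderiv ℝ (kernel s) z (wpos z.1, 0)) +
      (∫ z in tsupport u₁ ×ˢ tsupport u₂,
        u₁ z.1 * u₂ z.2 * fderiv ℝ (kernel s) z.swap (wpos z.swap.1, 0)) =
      -(homDim n + 2 * s) *
        ∫ z in tsupport u₁ ×ˢ tsupport u₂, u₁ z.1 * u₂ z.2 * kernel s z := by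
    rw [← integral_add (integrableOn_prod_mul hu₁ hu₂ hc₁ hc₂ (hdk.mono hsub))
      (integrableOn_prod_mul (H := fun z => fderiv ℝ (kernel s) z.swap (wpos z.swap.1, 0))
        hu₁ hu₂ hc₁ hc₂ (hdk.comp continuous_swap.continuousOn fun w hw => hsub' ⟨hw.2, hw.1⟩)),
      ← integral_const_mul]
    refine setIntegral_congr_fun (hm₁.prod hm₂) fun z hz => ?_
    have hne : z.1 ≠ z.2 := hsub hz
    have he := fderiv_kernel_wpos (s := s) hne
    have hsplit : ((wpos z.1, wpos z.2) : Heis n × Heis n) = (wpos z.1, 0) + (0, wpos z.2) := by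
      simp
    rw [hsplit, map_add, ← fderiv_kernel_swap hne] at he
    simp only [Prod.swap]
    linear_combination u₁ z.1 * u₂ z.2 * he
  -- With S the double integral of the kernel, the left side is 2QS - (Q+2s)S and the right side is
  -- (2s-Q)/2 · (-2S).
  rw [hS₁, hS₂, hD₁, hD₂]
  linear_combination hD

end Heis

theorem theorem5p1 (n : ℕ) (s : ℝ) (hs₀ : 0 < s) (hs₁ : s < 1)
    (u₁ u₂ : Heis n → ℝ) (hu₁ : Heis.MemW11 u₁) (hu₂ : Heis.MemW11 u₂)
    (hc₁ : HasCompactSupport u₁) (hc₂ : HasCompactSupport u₂)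
    (hd : Disjoint (tsupport u₁) (tsupport u₂))
    (g₁ g₂ : Heis n → (Fin n → ℝ) × (Fin n → ℝ))
    (hg₁ : Heis.IsSubgradient u₁ g₁) (hg₂ : Heis.IsSubgradient u₂ g₂) :
    -- `(-Δ)^s u₂` exists and is continuously differentiable off the support of `u₂`;
    -- likewise for `u₁`
    ((∀ p ∉ tsupport u₂, Heis.HasFracLaplacianAt s u₂ p (Heis.fracLaplacian s u₂ p)) ∧
      ContDiffOn ℝ 1 (Heis.fracLaplacian s u₂) (tsupport u₂)ᶜ) ∧
    ((∀ p ∉ tsupport u₁, Heis.HasFracLaplacianAt s u₁ p (Heis.fracLaplacian s u₁ p)) ∧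
      ContDiffOn ℝ 1 (Heis.fracLaplacian s u₁) (tsupport u₁)ᶜ) ∧
    -- the integrals on the right-hand side converge
    IntegrableOn (fun p => u₁ p * Heis.fracLaplacian s u₂ p) (tsupport u₁) volume ∧
    IntegrableOn (fun p => u₂ p * Heis.fracLaplacian s u₁ p) (tsupport u₂) volume ∧
    -- the identity whenever the vertical derivatives `Z u₁`, `Z u₂` are functions
    (∀ T₁ T₂ : Heis n → ℝ,
      Heis.HasWeakDeriv Heis.fieldZ u₁ T₁ → Heis.HasWeakDeriv Heis.fieldZ u₂ T₂ →
      IntegrableOn (fun p => Heis.wposDotGrad g₁ T₁ p * Heis.fracLaplacian s u₂ p)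
        (tsupport u₁) volume ∧
      IntegrableOn (fun p => Heis.wposDotGrad g₂ T₂ p * Heis.fracLaplacian s u₁ p)
        (tsupport u₂) volume ∧
      (∫ p in tsupport u₁, Heis.wposDotGrad g₁ T₁ p * Heis.fracLaplacian s u₂ p) +
          (∫ p in tsupport u₂, Heis.wposDotGrad g₂ T₂ p * Heis.fracLaplacian s u₁ p) =
        (2 * s - Heis.homDim n) / 2 * (∫ p in tsupport u₁, u₁ p * Heis.fracLaplacian s u₂ p) +
          (2 * s - Heis.homDim n) / 2 * (∫ p in tsupport u₂, u₂ p * Heis.fracLaplacian s u₁ p)) ∧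
    -- the identity in general, the vertical part `2 z (Z uⱼ)` acting as a distribution
    IntegrableOn (fun p => Heis.wposDotGrad g₁ 0 p * Heis.fracLaplacian s u₂ p)
      (tsupport u₁) volume ∧
    IntegrableOn (fun p => Heis.wposDotGrad g₂ 0 p * Heis.fracLaplacian s u₁ p)
      (tsupport u₂) volume ∧
    IntegrableOn (fun p => u₁ p * Heis.zDerivWeighted (Heis.fracLaplacian s u₂) p)
      (tsupport u₁) volume ∧
    IntegrableOn (fun p => u₂ p * Heis.zDerivWeighted (Heis.fracLaplacian s u₁) p)
      (tsupport u₂) volume ∧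
    ((∫ p in tsupport u₁, Heis.wposDotGrad g₁ 0 p * Heis.fracLaplacian s u₂ p) -
          ∫ p in tsupport u₁, u₁ p * Heis.zDerivWeighted (Heis.fracLaplacian s u₂) p) +
        ((∫ p in tsupport u₂, Heis.wposDotGrad g₂ 0 p * Heis.fracLaplacian s u₁ p) -
          ∫ p in tsupport u₂, u₂ p * Heis.zDerivWeighted (Heis.fracLaplacian s u₁) p) =
      (2 * s - Heis.homDim n) / 2 * (∫ p in tsupport u₁, u₁ p * Heis.fracLaplacian s u₂ p) +
        (2 * s - Heis.homDim n) / 2 * (∫ p in tsupport u₂, u₂ p * Heis.fracLaplacian s u₁ p) := by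
  have hn₁ : tsupport u₁ ⊆ (tsupport u₂)ᶜ := fun p h h' => Set.disjoint_left.1 hd h h'
  have hn₂ : tsupport u₂ ⊆ (tsupport u₁)ᶜ := fun p h h' => Set.disjoint_left.1 hd h' h
  have ho₁ : IsOpen (tsupport u₁)ᶜ := (isClosed_tsupport u₁).isOpen_compl
  have ho₂ : IsOpen (tsupport u₂)ᶜ := (isClosed_tsupport u₂).isOpen_compl
  have hf₁ : ContDiffOn ℝ ∞ (Heis.fracLaplacian s u₁) (tsupport u₁)ᶜ :=
    Heis.contDiffOn_fracLaplacian hu₁.1 hc₁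
  have hf₂ : ContDiffOn ℝ ∞ (Heis.fracLaplacian s u₂) (tsupport u₂)ᶜ :=
    Heis.contDiffOn_fracLaplacian hu₂.1 hc₂
  have hcf₁ := hf₁.continuousOn.mono hn₂
  have hcf₂ := hf₂.continuousOn.mono hn₁
  have main := Heis.fracLaplacian_euler_identity (s := s) hu₁.1 hu₂.1 hc₁ hc₂ hd
  -- Undoing the integration by parts gives the distributional identity. It applies because each
  -- potential is smooth near the other function's support.
  rw [← hg₁.pairing_eq hu₁.1 hc₁ ho₂ hn₁ hf₂, ← hg₂.pairing_eq hu₂.1 hc₂ ho₁ hn₂ hf₁] at main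
  refine ⟨⟨fun p hp => ?_, hf₂.of_le (by exact_mod_cast le_top)⟩,
    ⟨fun p hp => ?_, hf₁.of_le (by exact_mod_cast le_top)⟩,
    hu₁.1.integrableOn.mul_continuousOn hcf₂ hc₁, hu₂.1.integrableOn.mul_continuousOn hcf₁ hc₂,
    fun T₁ T₂ hT₁ hT₂ => ?_, hg₁.integrableOn hc₁ hcf₂, hg₂.integrableOn hc₂ hcf₁,
    Heis.integrableOn_mul_zDerivWeighted hu₁.1 hc₁ ho₂ hn₁ hf₂,
    Heis.integrableOn_mul_zDerivWeighted hu₂.1 hc₂ ho₁ hn₂ hf₁, main⟩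
  · rw [Heis.fracLaplacian_eq hc₂ hp]
    exact Heis.hasFracLaplacianAt_neg_integral hc₂ hp
  · rw [Heis.fracLaplacian_eq hc₁ hp]
    exact Heis.hasFracLaplacianAt_neg_integral hc₁ hp
  · obtain ⟨hi₁, he₁⟩ := hT₁.setIntegral_wposDotGrad hg₁ hc₁ ho₂ hn₁ hf₂
    obtain ⟨hi₂, he₂⟩ := hT₂.setIntegral_wposDotGrad hg₂ hc₂ ho₁ hn₂ hf₁
    exact ⟨hi₁, hi₂, by rw [he₁, he₂]; exact main⟩
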